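/- **Setting.** Let $\Omega=\{0,1\}^{\mathbb N}$, $\Omega_n=\{0,1\}^n$, and let $\pi_n:\Omega\to\Omega_n$ be the projection onto the first $n$ coordinates. Let $G_2^{(n)}$ be the group, under pointwise addition, of all functions $\Omega\to\mathbb F_2$ of the form $f\circ\pi_n$ with $f:\Omega_n\to\mathbb F_2$, and let $G_2=\bigcup_{n} G_2^{(n)}$ (a countable abelian group isomorphic to $\bigoplus_{j=1}^\infty\mathbb Z/2\mathbb Z$). Let $\mathbf 1\in G_2$ be the constant function $1$. For $E\subseteq\Omega$ let $|E|_n$ be the number of $\tau\in\Omega_n$ with $\pi_n^{-1}(\tau)\subseteq E$. Put $$U(n,k)=\{g\in G_2^{(n)}: |\{\omega\in\Omega: g(\omega)\ne 0\}|_n\le k\},\qquad V(n,k)=U(n,k)+\mathbf 1 .$$ A subset $S$ of an abelian group $G$ is a *set of chromatic recurrence* if for every $k\in\mathbb N$ and every partition $G=\bigcup_{j=1}^k A_j$ there is a $j\le k$ with $(A_j-A_j)\cap S\neq\varnothing$. It is a *set of topological recurrence* if for every action $T$ of $G$ by homeomorphisms on a compact metric space $X$ all of whose orbits are dense, and every nonempty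 open $U\subseteq X$, there is a $g\in S$ with $U\cap T^gU\ne\varnothing$. **Lemma 4.1.** Let $(n_i)_{i\in\mathbb N}$ and $(k_i)_{i\in\mathbb N}$ be strictly increasing sequences of natural numbers. 1. If $g_i\in G_2^{(n_i)}$ for each $i$, then $\Bigl(\bigcup_{i}\bigl(g_i+U(n_i,k_i)\bigr)\Bigr)\setminus\{0\}$ is a set of chromatic recurrence, and it is a set of topological recurrence. 2. Let $S=\bigcup_{i}V(n_i,k_i)$. For every $g\in G_2$, the translate $g+S$ is a set of topological recurrence, and in fact $(g+S)\setminus\{0\}$ is a set of topological recurrence. -/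

import Mathlib

universe u

namespace HammingRecurrence

section Recurrence

open scoped Pointwise

/-- `S` is a set of chromatic recurrence: every finite partition of `G` has a cell whose
difference set meets `S`. -/
def IsChromaticRecurrence {G : Type*} [AddCommGroup G] (S : Set G) : Prop :=
  ∀ (k : ℕ) (A : Fin k → Set G),
    Pairwise (fun i j => Disjoint (A i) (A j)) → (⋃ j, A j) = Set.univ →
      ∃ j, ((A j - A j) ∩ S).Nonempty

/-- `S` is a set of topological recurrence: for every minimal action of `G` by homeomorphisms
on a compact metric space `X` and every nonempty open `U ⊆ X`, some `g ∈ S` has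
`U ∩ T^g U ≠ ∅`.  (`AddAction.IsMinimal G X` says that all orbits are dense; the
homeomorphism `T^g` is `x ↦ g +ᵥ x`.) -/
def IsTopologicalRecurrence {G : Type*} [AddCommGroup G] (S : Set G) : Prop :=
  ∀ (X : Type u) [MetricSpace X] [CompactSpace X] [AddAction G X] [ContinuousConstVAdd G X]
    [AddAction.IsMinimal G X] (U : Set X),
    IsOpen U → U.Nonempty → ∃ g ∈ S, (U ∩ (fun x : X => g +ᵥ x) '' U).Nonempty

end Recurrence

/-- The Cantor space `{0,1}^ℕ` (coordinates are numbered from `0`). -/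
abbrev Omega : Type := ℕ → Fin 2

/-- The finite words `{0,1}^n`. -/
abbrev OmegaFin (n : ℕ) : Type := Fin n → Fin 2

/-- The projection of `Omega` onto its first `n` coordinates. -/
def proj (n : ℕ) (ω : Omega) : OmegaFin n := fun i => ω i

/-- The cylinder set `[τ]`. -/
def cylinder {n : ℕ} (τ : OmegaFin n) : Set Omega := proj n ⁻¹' {τ}

/-- `|E|_n`: the number of words `τ` of length `n` with `[τ] ⊆ E`. -/
noncomputable def content (n : ℕ) (E : Set Omega) : ℕ :=
  {τ : OmegaFin n | cylinder τ ⊆ E}.ncard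

/-- `G_p^(n)`: the functions `Omega → 𝔽_p` of the form `f ∘ π_n`, as a group under pointwise
addition. -/
def level (p n : ℕ) : AddSubgroup (Omega → ZMod p) where
  carrier := {g | ∃ f : OmegaFin n → ZMod p, g = f ∘ proj n}
  zero_mem' := ⟨0, rfl⟩
  add_mem' := by
    rintro _ _ ⟨f, rfl⟩ ⟨f', rfl⟩
    exact ⟨f + f', rfl⟩
  neg_mem' := by
    rintro _ ⟨f, rfl⟩
    exact ⟨-f, rfl⟩

theorem level_mono (p : ℕ) {m n : ℕ} (h : m ≤ n) : level p m ≤ level p n := by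
  rintro _ ⟨f, rfl⟩
  exact ⟨fun τ => f fun i => τ (Fin.castLE h i), rfl⟩

/-- `G_p = ⋃_n G_p^(n)`, the group of functions `Omega → 𝔽_p` that depend on finitely many
coordinates only. -/
def Gp (p : ℕ) : AddSubgroup (Omega → ZMod p) where
  carrier := {g | ∃ n, g ∈ level p n}
  zero_mem' := ⟨0, (level p 0).zero_mem⟩
  add_mem' := by
    rintro a b ⟨m, ha⟩ ⟨n, hb⟩
    exact ⟨max m n, (level p _).add_mem (level_mono p (le_max_left m n) ha)
      (level_mono p (le_max_right m n) hb)⟩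
  neg_mem' := by
    rintro a ⟨n, ha⟩
    exact ⟨n, (level p n).neg_mem ha⟩

/-- The constant function `1`, as an element of `G_p`. -/
def const1 (p : ℕ) : Gp p := ⟨fun _ => 1, 0, fun _ => 1, rfl⟩

/-- `U(n,k)`: the Hamming ball of scale `n` and radius `k` around `0`. -/
def hammingU (p n k : ℕ) : Set (Gp p) :=
  {g | (g : Omega → ZMod p) ∈ level p n ∧
    content n {ω | (g : Omega → ZMod p) ω ≠ 0} ≤ k}

/-- The translate `g + S`. -/
def translate {G : Type*} [AddCommGroup G] (g : G) (S : Set G) : Set G :=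
  (fun s => g + s) '' S

/-- `V(n,k) = U(n,k) + 1`: the Hamming ball of scale `n` and radius `k` around the constant
function `1`. -/
def hammingV (p n k : ℕ) : Set (Gp p) := translate (const1 p) (hammingU p n k)

end HammingRecurrence

/-! Both kinds of recurrence follow once every finite coloring of `Gp 2` has two distinct points of
one color whose difference lies in the given set. An element of level `n` is the indicator of a set
`W` of words, so the task is to find like-colored sets whose symmetric difference is close to `W`.
If `W` is large, `exists_same_color_card_symmDiff` applies, a Kneser-type statement. It rests on
`sum_altCount`, a mod 2 form of Ky Fan's lemma for signed sets: an antipodal choice of signs admits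
an alternating maximal chain. With signs read off from least colors, each alternation forces the
least color up, and the colors run out. If `W` is small, two singletons suffice. -/

namespace HammingRecurrence

open Finset

/-! ### A parity lemma of Ky Fan type -/

section AlternatingChains

variable {α : Type*} [DecidableEq α]

/-- A signed set is a pair `(A, B)` with support `A` and positive part `B ⊆ A`. Given a sign `s` for
every signed set, this is the number modulo 2 of the maximal chains of nonempty signed sets
below `(A, B)` along which the sign alternates, with the sign `b` at the top (`n` is the
cardinality of `A`). -/
def altCount (s : Finset α → Finset α → Bool) : ℕ → Bool → Finset α → Finset α → ZMod 2
  | 0, _, _, _ => 1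
  | n + 1, b, A, B =>
    if s A B = b then ∑ a ∈ A, altCount s n (!b) (A.erase a) (B.erase a) else 0

theorem sum_sum_erase_eq_zero (A : Finset α) (f : α → α → ZMod 2)
    (hf : ∀ a b, f a b = f b a) : ∑ a ∈ A, ∑ b ∈ A.erase a, f a b = 0 := by
  rw [Finset.sum_sigma']
  refine Finset.sum_involution (fun p _ => ⟨p.2, p.1⟩) ?_ ?_ ?_ ?_
  · rintro ⟨a, b⟩ -
    simp only
    rw [hf b a]
    exact CharTwo.add_self_eq_zero _
  · rintro ⟨a, b⟩ h - h'
    simp only [mem_sigma, mem_erase] at h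
    simp only [Sigma.mk.injEq] at h'
    exact h.2.1 h'.1
  · rintro ⟨a, b⟩ h
    simp only [mem_sigma, mem_erase] at h ⊢
    exact ⟨h.2.2, h.2.1.symm, h.1⟩
  · rintro ⟨a, b⟩ -
    rfl

/-- Only one top sign matches `s A B`, leaving the facet counts with the opposite sign. Over all
facets the two signs have equal totals mod 2, since each face of codimension two lies in exactly two
facets. -/
theorem altCount_true_add_false (s : Finset α → Finset α → Bool) (n : ℕ) :
    ∀ A B : Finset α, A.card = n + 1 →
      altCount s (n + 1) true A B + altCount s (n + 1) false A B =
        ∑ a ∈ A, altCount s n true (A.erase a) (B.erase a) := by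
  induction n with
  | zero =>
    intro A B hA
    cases h : s A B <;> simp [altCount, h]
  | succ n ih =>
    intro A B hA
    have key : ∑ a ∈ A, altCount s (n + 1) true (A.erase a) (B.erase a) +
        ∑ a ∈ A, altCount s (n + 1) false (A.erase a) (B.erase a) = 0 := by
      rw [← Finset.sum_add_distrib]
      rw [Finset.sum_congr rfl fun a ha => ih (A.erase a) (B.erase a)
        (by rw [card_erase_of_mem ha, hA]; rfl)]
      refine sum_sum_erase_eq_zero A
        (fun a b => altCount s n true ((A.erase a).erase b) ((B.erase a).erase b)) ?_
      intro a b
      rw [erase_right_comm, erase_right_comm (s := B)]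
    rw [altCount, altCount]
    cases h : s A B
    · simp
    · simpa using (CharTwo.add_eq_zero.1 key).symm

theorem altCount_compl (s : Finset α → Finset α → Bool)
    (hs : ∀ A B : Finset α, A.Nonempty → B ⊆ A → s A (A \ B) = !s A B) (n : ℕ) :
    ∀ (b : Bool) (A B : Finset α), A.card = n → B ⊆ A →
      altCount s n b A (A \ B) = altCount s n (!b) A B := by
  induction n with
  | zero => intros; rfl
  | succ n ih =>
    intro b A B hA hB
    rw [altCount, altCount, hs A B (card_pos.1 (by omega)) hB]
    have : ∀ a ∈ A, altCount s n (!b) (A.erase a) ((A \ B).erase a) =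
        altCount s n (!!b) (A.erase a) (B.erase a) := by
      intro a ha
      rw [← ih (!b) (A.erase a) (B.erase a) (by rw [card_erase_of_mem ha, hA]; rfl)
        (erase_subset_erase a hB)]
      congr 1
      ext x
      simp only [mem_erase, mem_sdiff]
      tauto
    rw [Finset.sum_congr rfl this]
    cases s A B <;> cases b <;> simp

/-- The alternating maximal chains with a prescribed top sign are odd in number. -/
theorem sum_altCount (s : Finset α → Finset α → Bool)
    (hs : ∀ A B : Finset α, A.Nonempty → B ⊆ A → s A (A \ B) = !s A B) (A : Finset α) :
    ∑ B ∈ A.powerset, altCount s A.card true A B = 1 := by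
  induction A using Finset.induction_on with
  | empty => simp [altCount]
  | insert k A hk ih =>
    have hcard : (insert k A).card = A.card + 1 := card_insert_of_notMem hk
    rw [sum_powerset_insert hk]
    -- The antipodal map carries the hemisphere `k ∉ B` to `k ∈ B` and flips the top sign.
    have h1 : ∑ B ∈ A.powerset, altCount s (insert k A).card true (insert k A) B =
        ∑ B ∈ A.powerset, altCount s (insert k A).card false (insert k A) (insert k B) := by
      refine Finset.sum_bij' (fun B _ => A \ B) (fun B _ => A \ B) ?_ ?_ ?_ ?_ ?_
      · intro B _; simp
      · intro B _; simp
      · intro B hB; simpa using hB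
      · intro B hB; simpa using hB
      · intro B hB
        have hB' := mem_powerset.1 hB
        have := altCount_compl s hs _ false (insert k A) B rfl
          (hB'.trans (subset_insert _ _))
        rw [insert_sdiff_of_notMem _ (fun h => hk (hB' h))] at this
        simpa using this.symm
    rw [h1, ← Finset.sum_add_distrib]
    have h2 : ∀ B ∈ A.powerset,
        altCount s (insert k A).card false (insert k A) (insert k B) +
          altCount s (insert k A).card true (insert k A) (insert k B) =
        altCount s A.card true A B +
          ∑ a ∈ A, altCount s A.card true ((insert k A).erase a) ((insert k B).erase a) := by
      intro B hB
      rw [hcard, add_comm, altCount_true_add_false s _ _ _ hcard, sum_insert hk,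
        erase_insert hk, erase_insert (fun h => hk (mem_powerset.1 hB h))]
    rw [Finset.sum_congr rfl h2, Finset.sum_add_distrib, ih, Finset.sum_comm,
      Finset.sum_eq_zero, add_zero]
    -- Erasing `a ≠ k` forgets whether `a ∈ B`, so the terms cancel in pairs; only the equator,
    -- where `k` is erased, survives.
    intro a ha
    have hak : a ≠ k := fun h => hk (h ▸ ha)
    refine Finset.sum_involution
      (fun B _ => if a ∈ B then B.erase a else insert a B) ?_ ?_ ?_ ?_
    · intro B _
      have : (insert k (if a ∈ B then B.erase a else insert a B)).erase a =
          (insert k B).erase a := by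
        ext x
        split_ifs <;> simp only [mem_erase, mem_insert] <;> tauto
      rw [this]
      exact CharTwo.add_self_eq_zero _
    · intro B _ _ h
      split_ifs at h with hB
      · exact notMem_erase a B (h.symm ▸ hB)
      · exact hB (h ▸ mem_insert_self a B)
    · intro B hB
      rw [mem_powerset] at hB ⊢
      split_ifs
      · exact (erase_subset _ _).trans hB
      · exact insert_subset ha hB
    · intro B _
      by_cases hB : a ∈ B
      · simp [hB]
      · simp [hB]

end AlternatingChains

/-! ### Colorings of the subsets of a finite set -/

section Coloring

variable {α : Type*} [DecidableEq α]

/-- The colors, under `c`, of the subsets of `W` whose trace on `A` is `B` or `A \ B`. -/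
def traceColors (c : Finset α → ℕ) (W A B : Finset α) : Finset ℕ :=
  {D ∈ W.powerset | D ∩ A = B ∨ D ∩ A = A \ B}.image c

theorem traceColors_nonempty (c : Finset α → ℕ) {W A B : Finset α} (hA : A ⊆ W) (hB : B ⊆ A) :
    (traceColors c W A B).Nonempty :=
  ⟨c B, mem_image_of_mem c (mem_filter.2
    ⟨mem_powerset.2 (hB.trans hA), Or.inl (inter_eq_left.2 hB)⟩)⟩

theorem traceColors_compl (c : Finset α → ℕ) (W : Finset α) {A B : Finset α} (hB : B ⊆ A) :
    traceColors c W A (A \ B) = traceColors c W A B := by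
  simp only [traceColors, Finset.sdiff_sdiff_eq_self hB, or_comm]

theorem trace_erase {D A B : Finset α} (a : α) (h : D ∩ A = B) :
    D ∩ A.erase a = B.erase a := by
  rw [inter_erase, h]

theorem sdiff_erase_erase (A B : Finset α) (a : α) :
    (A \ B).erase a = A.erase a \ B.erase a := by
  ext x
  simp only [mem_erase, mem_sdiff]
  tauto

theorem traceColors_subset_erase (c : Finset α → ℕ) (W A B : Finset α) (a : α) :
    traceColors c W A B ⊆ traceColors c W (A.erase a) (B.erase a) := by
  refine image_subset_image fun D hD => ?_
  rw [mem_filter] at hD ⊢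
  refine ⟨hD.1, hD.2.imp (trace_erase a) fun h => ?_⟩
  rw [trace_erase a h, sdiff_erase_erase]

/-- A coloring of the subsets of `W` with `r ≤ d < |W|` colors has two sets of the same color
that are complementary in `W` up to at most `d` points. -/
theorem exists_same_color_card_symmDiff (W : Finset α) (c : Finset α → ℕ) {r d : ℕ}
    (hc : ∀ D, c D < r) (hr : r ≤ d) (hd : d < W.card) :
    ∃ D D', D ⊆ W ∧ D' ⊆ W ∧ c D = c D' ∧ W.card ≤ (symmDiff D D').card + d := by
  classical
  by_contra! hcon
  -- Opposite traces on a large `A` make `D` and `D'` differ on all of `A`.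
  have hopp : ∀ A B D D' : Finset α, A ⊆ W → W.card ≤ A.card + d → D ⊆ W → D' ⊆ W →
      D ∩ A = B → D' ∩ A = A \ B → c D ≠ c D' := by
    intro A B D D' hA hcA hD hD' h1 h2 h3
    have hsub : A ⊆ symmDiff D D' := by
      intro x hx
      have e1 := Finset.ext_iff.1 h1 x
      have e2 := Finset.ext_iff.1 h2 x
      simp only [mem_inter, mem_sdiff] at e1 e2
      rw [mem_symmDiff]
      tauto
    have := hcon D D' hD hD' h3
    have := card_le_card hsub
    omega
  let j : Finset α → Finset α → ℕ := fun A B => sInf (traceColors c W A B : Set ℕ)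
  have hj_mem : ∀ A B, A ⊆ W → B ⊆ A → ∃ D ⊆ W, (D ∩ A = B ∨ D ∩ A = A \ B) ∧ c D = j A B := by
    intro A B hA hB
    have := Nat.sInf_mem (s := (traceColors c W A B : Set ℕ)) (traceColors_nonempty c hA hB)
    simp only [traceColors, coe_image, Set.mem_image, mem_coe, mem_filter, mem_powerset] at this
    obtain ⟨D, ⟨h1, h2⟩, h3⟩ := this
    exact ⟨D, h1, h2, by simpa [j, traceColors] using h3⟩
  -- For large `A` the sign records which of the two opposite traces attains the least color; by
  -- `hopp` only one does. For other `A` any antipodal rule will do.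
  let P : Finset α → Finset α → Prop := fun A B =>
    if A ⊆ W ∧ W.card ≤ A.card + d then ∃ D ⊆ W, D ∩ A = B ∧ c D = j A B
    else ∃ h : A.Nonempty, h.choose ∈ B
  let s : Finset α → Finset α → Bool := fun A B => decide (P A B)
  have hs : ∀ A B : Finset α, A.Nonempty → B ⊆ A → s A (A \ B) = !s A B := by
    intro A B hne hB
    have : P A (A \ B) ↔ ¬ P A B := by
      by_cases hA : A ⊆ W ∧ W.card ≤ A.card + d
      · simp only [P, if_pos hA]
        have hj : j A (A \ B) = j A B := by simp only [j, traceColors_compl c W hB]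
        rw [hj]
        constructor
        · rintro ⟨D', hD', h1', h2'⟩ ⟨D, hD, h1, h2⟩
          exact hopp A B D D' hA.1 hA.2 hD hD' h1 h1' (h2.trans h2'.symm)
        · intro h
          obtain ⟨D, hD, h1 | h1, h2⟩ := hj_mem A B hA.1 hB
          · exact absurd ⟨D, hD, h1, h2⟩ h
          · exact ⟨D, hD, h1, h2⟩
      · simp only [P, if_neg hA, hne, exists_true_left, mem_sdiff, hne.choose_spec, true_and]
    simp only [s]
    by_cases h : P A B <;> simp [h, this]
  have hchain : ∀ (t : ℕ) (b : Bool) (A B : Finset α), A ⊆ W → B ⊆ A →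
      A.card + d = W.card + t → altCount s A.card b A B ≠ 0 → s A B = b ∧ t ≤ j A B := by
    intro t
    induction t with
    | zero =>
      intro b A B _ _ hcard hne
      refine ⟨?_, Nat.zero_le _⟩
      obtain ⟨m, hm⟩ : ∃ m, A.card = m + 1 := ⟨A.card - 1, by omega⟩
      rw [hm, altCount] at hne
      by_contra h
      exact hne (if_neg h)
    | succ t ih =>
      intro b A B hA hB hcard hne
      obtain ⟨m, hm⟩ : ∃ m, A.card = m + 1 := ⟨A.card - 1, by omega⟩
      rw [hm, altCount] at hne
      have hsb : s A B = b := by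
        by_contra h
        exact hne (if_neg h)
      refine ⟨hsb, ?_⟩
      rw [if_pos hsb] at hne
      obtain ⟨a, ha, hne⟩ := Finset.exists_ne_zero_of_sum_ne_zero hne
      have hcA : (A.erase a).card = m := by rw [card_erase_of_mem ha, hm]; rfl
      have hAe : A.erase a ⊆ W := (erase_subset _ _).trans hA
      have hBe : B.erase a ⊆ A.erase a := erase_subset_erase a hB
      obtain ⟨hse, hje⟩ := ih (!b) (A.erase a) (B.erase a) hAe hBe (by omega) (by rwa [hcA])
      have hle : j (A.erase a) (B.erase a) ≤ j A B :=
        csInf_le_csInf (OrderBot.bddBelow _) (traceColors_nonempty c hA hB)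
          (coe_subset.2 (traceColors_subset_erase c W A B a))
      have hbig : A ⊆ W ∧ W.card ≤ A.card + d := ⟨hA, by omega⟩
      have hbige : A.erase a ⊆ W ∧ W.card ≤ (A.erase a).card + d := ⟨hAe, by omega⟩
      -- An unchanged least color would be attained on the same side, so the sign would not
      -- alternate.
      have hneq : j (A.erase a) (B.erase a) ≠ j A B := by
        intro heq
        have hiff : P (A.erase a) (B.erase a) ↔ P A B := by
          simp only [P, if_pos hbig, if_pos hbige]
          constructor
          · rintro ⟨D, hD, h1, h2⟩
            obtain ⟨D', hD', h1' | h1', h2'⟩ := hj_mem A B hA hB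
            · exact ⟨D', hD', h1', h2'⟩
            · refine absurd (h2.trans (heq.trans h2'.symm))
                (hopp _ _ D D' hAe hbige.2 hD hD' h1 ?_)
              rw [trace_erase a h1', sdiff_erase_erase]
          · rintro ⟨D, hD, h1, h2⟩
            exact ⟨D, hD, trace_erase a h1, h2.trans heq.symm⟩
        have : s (A.erase a) (B.erase a) = s A B := by simp only [s, hiff]
        rw [hse, hsb] at this
        cases b <;> simp at this
      omega
  have hsum := sum_altCount s hs W
  obtain ⟨B, hB, hne⟩ := Finset.exists_ne_zero_of_sum_ne_zero (hsum.symm ▸ one_ne_zero)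
  have hBW := mem_powerset.1 hB
  -- The `d` steps from size `|W| - d` up to `W` push the least color to at least `d ≥ r`.
  obtain ⟨-, hdj⟩ := hchain d true W B Subset.rfl hBW rfl hne
  obtain ⟨D, -, -, hD⟩ := hj_mem W B Subset.rfl hBW
  have := hc D
  omega

end Coloring

/-! ### Level functions as indicators -/

section Indicator

/-- The indicator function of the union of the cylinders of the words in `D`. -/
def cylInd (n : ℕ) (D : Finset (OmegaFin n)) : Gp 2 :=
  ⟨fun ω => if proj n ω ∈ D then 1 else 0, n, fun τ => if τ ∈ D then 1 else 0, rfl⟩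

theorem cylInd_mem_level (n : ℕ) (D : Finset (OmegaFin n)) :
    (cylInd n D : Omega → ZMod 2) ∈ level 2 n :=
  ⟨fun τ => if τ ∈ D then 1 else 0, rfl⟩

theorem proj_surjective (n : ℕ) : Function.Surjective (proj n) := fun τ =>
  ⟨fun i => if h : i < n then τ ⟨i, h⟩ else 0, by
    funext i
    simp [proj]⟩

theorem exists_eq_cylInd {n : ℕ} {g : Gp 2} (hg : (g : Omega → ZMod 2) ∈ level 2 n) :
    ∃ W, g = cylInd n W := by
  obtain ⟨f, hf⟩ := hg
  refine ⟨univ.filter fun τ => f τ = 1, Subtype.ext ?_⟩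
  rw [hf]
  funext ω
  simp only [cylInd, Function.comp, mem_filter, mem_univ, true_and]
  generalize f (proj n ω) = z
  revert z
  decide

theorem cylInd_sub (n : ℕ) (D D' : Finset (OmegaFin n)) :
    cylInd n D - cylInd n D' = cylInd n (symmDiff D D') := by
  refine Subtype.ext ?_
  funext ω
  change (if _ then (1 : ZMod 2) else 0) - (if _ then (1 : ZMod 2) else 0) =
    if _ then (1 : ZMod 2) else 0
  simp only [mem_symmDiff]
  by_cases h : proj n ω ∈ D <;> by_cases h' : proj n ω ∈ D' <;> simp [h, h']

theorem cylInd_eq_zero {n : ℕ} {D : Finset (OmegaFin n)} (h : cylInd n D = 0) : D = ∅ := by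
  refine eq_empty_of_forall_notMem fun τ hτ => ?_
  obtain ⟨ω, rfl⟩ := proj_surjective n τ
  have := congrFun (congrArg Subtype.val h) ω
  simp [cylInd, hτ] at this

theorem content_cylInd (n : ℕ) (D : Finset (OmegaFin n)) :
    content n {ω | (cylInd n D : Omega → ZMod 2) ω ≠ 0} = D.card := by
  rw [content, ← Set.ncard_coe_finset]
  congr 1
  ext τ
  simp only [Set.mem_ofPred_eq, mem_coe]
  constructor
  · intro h
    obtain ⟨ω, rfl⟩ := proj_surjective n τ
    have : (cylInd n D : Omega → ZMod 2) ω ≠ 0 := h rfl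
    by_contra hD
    exact this (if_neg hD)
  · rintro h ω (rfl : proj n ω = τ)
    change (if _ then (1 : ZMod 2) else 0) ≠ 0
    rw [if_pos h]
    exact one_ne_zero

theorem cylInd_mem_translate {n k : ℕ} {W D : Finset (OmegaFin n)}
    (h : (symmDiff D W).card ≤ k) : cylInd n D ∈ translate (cylInd n W) (hammingU 2 n k) := by
  refine ⟨cylInd n D - cylInd n W, ?_, add_sub_cancel _ _⟩
  rw [cylInd_sub]
  exact ⟨cylInd_mem_level _ _, (content_cylInd n _).trans_le h⟩

end Indicator

/-! ### From colorings to recurrence -/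

theorem exists_same_color_sub_mem {n k r : ℕ} (hr : r + 2 ≤ k) (hn : r < 2 ^ n) {g : Gp 2}
    (hg : (g : Omega → ZMod 2) ∈ level 2 n) (c : Gp 2 → Fin r) :
    ∃ x y, c x = c y ∧ x - y ∈ translate g (hammingU 2 n k) \ {0} := by
  obtain ⟨W, rfl⟩ := exists_eq_cylInd hg
  -- The 2 bounds the weight of a difference of two singletons. In the large case `d = k - 2 < |W|`
  -- also keeps the difference nonzero.
  rcases le_or_gt (W.card + 2) k with hW | hW
  · obtain ⟨τ, τ', hne, heq⟩ := Fintype.exists_ne_map_eq_of_card_lt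
      (fun τ : OmegaFin n => c (cylInd n {τ})) (by simpa using hn)
    refine ⟨_, _, heq, ?_⟩
    rw [cylInd_sub]
    have hcard : (symmDiff ({τ} : Finset (OmegaFin n)) {τ'}).card ≤ 2 :=
      (card_le_card symmDiff_le_sup).trans (card_union_le _ _)
    refine ⟨cylInd_mem_translate ?_, fun h => ?_⟩
    · refine (card_le_card symmDiff_le_sup).trans ((card_union_le _ _).trans ?_)
      omega
    · have := cylInd_eq_zero h
      exact hne (singleton_injective (symmDiff_eq_bot.1 this))
  · obtain ⟨D, D', hD, hD', heq, hcard⟩ := exists_same_color_card_symmDiff W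
      (fun D => (c (cylInd n D) : ℕ)) (r := r) (d := k - 2) (fun D => (c _).2) (by omega)
      (by omega)
    refine ⟨_, _, Fin.ext heq, ?_⟩
    rw [cylInd_sub]
    have hsub : symmDiff D D' ⊆ W := symmDiff_le_sup.trans (union_subset hD hD')
    refine ⟨cylInd_mem_translate ?_, fun h => ?_⟩
    · rw [symmDiff_of_le hsub, card_sdiff_of_subset hsub]
      omega
    · rw [cylInd_eq_zero h, card_empty] at hcard
      omega

theorem isChromaticRecurrence_of_coloring {G : Type*} [AddCommGroup G] {S : Set G}
    (h : ∀ (r : ℕ) (c : G → Fin r), ∃ x y, c x = c y ∧ x - y ∈ S) :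
    IsChromaticRecurrence S := by
  intro r A _ hA
  have hmem : ∀ x, ∃ j, x ∈ A j := fun x => Set.mem_iUnion.1 (hA ▸ Set.mem_univ x)
  choose c hc using hmem
  obtain ⟨x, y, hxy, hS⟩ := h r c
  exact ⟨c x, x - y, Set.sub_mem_sub (hc x) (hxy ▸ hc y), hS⟩

/-- By minimality and compactness finitely many translates of `U` cover `X`. Color `x` by a
translate containing `x +ᵥ p`; for like-colored `x`, `y`, the element `x - y` carries a point of `U`
into `U`. -/
theorem isTopologicalRecurrence_of_coloring {G : Type*} [AddCommGroup G] {S : Set G}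
    (h : ∀ (r : ℕ) (c : G → Fin r), ∃ x y, c x = c y ∧ x - y ∈ S) :
    IsTopologicalRecurrence.{u} S := by
  intro X _ _ _ _ _ U hU hne
  obtain ⟨I, hI⟩ := isCompact_univ.exists_finite_cover_vadd G hU hne
  obtain ⟨p, -⟩ := hne
  have hmem : ∀ x : G, ∃ i : I, -(i : G) +ᵥ (x +ᵥ p) ∈ U := by
    intro x
    obtain ⟨i, hi, hx⟩ := Set.mem_iUnion₂.1 (hI (Set.mem_univ (x +ᵥ p)))
    exact ⟨⟨i, hi⟩, Set.mem_vadd_set_iff_neg_vadd_mem.1 hx⟩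
  choose c hc using hmem
  obtain ⟨x, y, hxy, hS⟩ := h I.card (fun x => I.equivFin (c x))
  have hxy : c x = c y := I.equivFin.injective hxy
  refine ⟨x - y, hS, _, hc x, _, hc y, ?_⟩
  simp only [vadd_vadd, hxy]
  congr 1
  abel

theorem IsTopologicalRecurrence.mono {G : Type*} [AddCommGroup G] {S S' : Set G} (hS : S ⊆ S')
    (h : IsTopologicalRecurrence.{u} S) : IsTopologicalRecurrence.{u} S' := by
  intro X _ _ _ _ _ U hU hne
  obtain ⟨g, hg, hgU⟩ := h X U hU hne
  exact ⟨g, hS hg, hgU⟩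

theorem exists_same_color_sub_mem_iUnion {n k : ℕ → ℕ} (hn : StrictMono n) (hk : StrictMono k)
    {g : ℕ → Gp 2} (hg : ∀ i, (g i : Omega → ZMod 2) ∈ level 2 (n i)) (r : ℕ)
    (c : Gp 2 → Fin r) :
    ∃ x y, c x = c y ∧ x - y ∈ (⋃ i, translate (g i) (hammingU 2 (n i) (k i))) \ {0} := by
  have hr : r < 2 ^ n (r + 2) := calc
    r < r + 2 := by omega
    _ ≤ n (r + 2) := hn.id_le _
    _ < 2 ^ n (r + 2) := Nat.lt_two_pow_self
  obtain ⟨x, y, hxy, h, h0⟩ :=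
    exists_same_color_sub_mem (hk.id_le (r + 2)) hr (hg (r + 2)) c
  exact ⟨x, y, hxy, Set.mem_iUnion.2 ⟨_, h⟩, h0⟩

end HammingRecurrence

theorem lemma4p1 (n k : ℕ → ℕ) (hn : StrictMono n) (hk : StrictMono k) :
    (∀ g : ℕ → HammingRecurrence.Gp 2,
      (∀ i, (g i : HammingRecurrence.Omega → ZMod 2) ∈ HammingRecurrence.level 2 (n i)) →
        HammingRecurrence.IsChromaticRecurrence
          ((⋃ i, HammingRecurrence.translate (g i)
            (HammingRecurrence.hammingU 2 (n i) (k i))) \ {0}) ∧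
        HammingRecurrence.IsTopologicalRecurrence.{u}
          ((⋃ i, HammingRecurrence.translate (g i)
            (HammingRecurrence.hammingU 2 (n i) (k i))) \ {0})) ∧
    (∀ g : HammingRecurrence.Gp 2,
      HammingRecurrence.IsTopologicalRecurrence.{u}
        (HammingRecurrence.translate g
          (⋃ i, HammingRecurrence.hammingV 2 (n i) (k i))) ∧
      HammingRecurrence.IsTopologicalRecurrence.{u}
        (HammingRecurrence.translate g
          (⋃ i, HammingRecurrence.hammingV 2 (n i) (k i)) \ {0})) := by
  refine ⟨fun g hg => ⟨HammingRecurrence.isChromaticRecurrence_of_coloring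
      (HammingRecurrence.exists_same_color_sub_mem_iUnion hn hk hg),
    HammingRecurrence.isTopologicalRecurrence_of_coloring
      (HammingRecurrence.exists_same_color_sub_mem_iUnion hn hk hg)⟩, fun g => ?_⟩
  suffices h : HammingRecurrence.IsTopologicalRecurrence.{u}
      (HammingRecurrence.translate g
        (⋃ i, HammingRecurrence.hammingV 2 (n i) (k i)) \ {0}) from
    ⟨h.mono Set.sdiff_subset, h⟩
  -- Since `g + V(n,k) = (g + 1) + U(n,k)`, part 1 applies with the constant center `g + 1`, after
  -- dropping the first `m` scales so that this center lies in every level.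
  obtain ⟨m, hm⟩ := (g + HammingRecurrence.const1 2).2
  have hshift : StrictMono fun i : ℕ => i + m := fun _ _ h => Nat.add_lt_add_right h m
  refine (HammingRecurrence.isTopologicalRecurrence_of_coloring
    (HammingRecurrence.exists_same_color_sub_mem_iUnion (hn.comp hshift) (hk.comp hshift)
      (g := fun _ => g + HammingRecurrence.const1 2) fun i =>
        HammingRecurrence.level_mono 2
          ((Nat.le_add_left m i).trans (hn.id_le (i + m))) hm)).mono
    (Set.sdiff_subset_sdiff_left ?_)
  refine Set.iUnion_subset fun i => ?_
  rintro _ ⟨u, hu, rfl⟩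
  exact ⟨HammingRecurrence.const1 2 + u, Set.mem_iUnion.2 ⟨i + m, u, hu, rfl⟩,
    (add_assoc _ _ _).symm⟩
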